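/- Let $(w_1,w_2)$ be a pair of one-dimensional standard Wiener processes on $[0,1]$ with continuous paths, defined on a common probability space and jointly Gaussian (that is, the family $\{w_1(t),w_2(t): t\in[0,1]\}$ is Gaussian; no other relation between $w_1$ and $w_2$ is assumed). Let $\mu_{w_1,w_2}$ be the law of $(w_1,w_2)$ on $C([0,1])\oplus C([0,1])$. Let $V$ be the bounded linear operator on $L_2([0,1])$ determined by $$E\int_0^1\varphi_1\,dw_1\int_0^1\varphi_2\,dw_2=\int_0^1\varphi_1\,V\varphi_2\,ds,\qquad \varphi_1,\varphi_2\in L_2([0,1]),$$ the integrals on the left being Wiener integrals. On $H=L_2([0,1],\mathbb R^2)=L_2([0,1])\oplus L_2([0,1])$, with the scalar product $(\varphi,\psi)=\int_0^1\varphi_1\psi_1\,ds+\int_0^1\varphi_2\psi_2\,ds$, put $$S\varphi=(\varphi_1+V\varphi_2,\;V^*\varphi_1+\varphi_2),\qquad (\varphi,\xi)=\int_0^1\varphi_1\,dw_1+\int_0^1\varphi_2\,dw_2,\qquad i(\varphi)(t)=\Bigl(\int_0^t\varphi_1\,ds,\int_0^t\varphi_2\,ds\Bigr).$$ **Lemma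 4.1.** Suppose that the operator norm satisfies $\|V\|<1$. Then $S$ has a bounded inverse, and for every $h\in H$ the vector $i(h)$ is an admissible shift for $\mu_{w_1,w_2}$, i.e. the image $\mu^h$ of $\mu_{w_1,w_2}$ under $x\mapsto x+i(h)$ is absolutely continuous with respect to $\mu_{w_1,w_2}$. Its density, evaluated at $(w_1,w_2)$, is $$\frac{d\mu^h}{d\mu_{w_1,w_2}}(w_1,w_2)=\exp\Bigl\{(S^{-1}h,\xi)-\tfrac12(S^{-1}h,h)\Bigr\}\qquad\text{almost surely.}$$ -/

import Mathlib

open MeasureTheory ProbabilityTheory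
open scoped unitInterval InnerProductSpace

noncomputable section

namespace CorrelatedWiener

/-! ### The spaces -/

/-- The real Hilbert space `L₂([0,1])` (with respect to Lebesgue measure). -/
abbrev L2I : Type := Lp ℝ 2 (volume : Measure I)

/-- The Hilbert space `H = L₂([0,1], ℝ²) = L₂([0,1]) ⊕ L₂([0,1])`, with the scalar product
`(φ, ψ) = ∫ φ₁ ψ₁ + ∫ φ₂ ψ₂`. -/
abbrev L2Pair : Type := WithLp 2 (L2I × L2I)

/-- The Borel `σ`-algebra of `C([0,1])` with the uniform norm. -/
instance instMeasurableSpaceC : MeasurableSpace C(I, ℝ) := borel _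

instance instBorelSpaceC : BorelSpace C(I, ℝ) := ⟨rfl⟩

/-! ### Wiener processes -/

/-- A one-dimensional (standard) Wiener process on `[0,1]`, as a random element of `C([0,1])`. -/
structure IsWienerProcess {Ω : Type*} [MeasurableSpace Ω] (P : Measure Ω)
    (w : Ω → C(I, ℝ)) : Prop where
  measurable : Measurable w
  zero : ∀ᵐ ω ∂P, w ω 0 = 0
  indep : HasIndepIncrements (fun (t : I) (ω : Ω) => w ω t) P
  law : ∀ s t : I, s ≤ t →
    HasLaw (fun ω => w ω t - w ω s) (gaussianReal 0 ((t : ℝ) - (s : ℝ)).toNNReal) P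

/-- The processes `w₁` and `w₂` are jointly Gaussian: the family
`(w₁(t))_{t ∈ [0,1]} ∪ (w₂(t))_{t ∈ [0,1]}` is Gaussian. -/
def JointlyGaussian {Ω : Type*} [MeasurableSpace Ω] (P : Measure Ω)
    (w₁ w₂ : Ω → C(I, ℝ)) : Prop :=
  IsGaussianProcess (Sum.elim (fun (t : I) (ω : Ω) => w₁ ω t) (fun (t : I) (ω : Ω) => w₂ ω t)) P

/-! ### The Wiener integral -/

/-- The indicator of `[0,t]` as an element of `L₂([0,1])`. -/
def ind (t : I) : L2I :=
  indicatorConstLp 2 (measurableSet_Icc : MeasurableSet (Set.Icc (0 : I) t))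
    (measure_ne_top volume _) (1 : ℝ)

/-- The linear map sending the formal combination `∑ cₜ δₜ` to the step function `∑ cₜ 1_[0,t]`. -/
def stepMap : (I →₀ ℝ) →ₗ[ℝ] L2I := Finsupp.linearCombination ℝ ind

lemma inner_ind (s t : I) : ⟪ind s, ind t⟫_ℝ = min (s : ℝ) (t : ℝ) := by
  have h : Set.Icc (0 : I) s ∩ Set.Icc (0 : I) t = Set.Icc 0 (min s t) := by
    rw [Set.Icc_inter_Icc]; simp
  rw [ind, ind, L2.real_inner_indicatorConstLp_one_indicatorConstLp_one, h, Measure.real,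
    unitInterval.volume_Icc]
  rcases le_total s t with hst | hst
  · simp [hst, s.2.1]
  · simp [hst, t.2.1]

/-- Step functions are dense in `L₂([0,1])`. -/
lemma denseRange_stepMap : DenseRange stepMap := by
  have key : (LinearMap.range stepMap).topologicalClosure = ⊤ := by
    rw [Submodule.topologicalClosure_eq_top_iff, Submodule.eq_bot_iff]
    intro f hf
    have hint : Integrable f (volume : Measure I) :=
      (Lp.memLp f).integrable (by norm_num)
    have h0 : ∀ t : I, ∫ x in Set.Icc 0 t, f x = 0 := by
      intro t
      have h1 := (Submodule.mem_orthogonal _ f).1 hf (ind t) ⟨Finsupp.single t 1, by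
        simp [stepMap]⟩
      rwa [ind, L2.inner_indicatorConstLp_one] at h1
    have hIic : ∀ t : I, Set.Icc (0 : I) t = Set.Iic t := fun t => by
      ext x; simp
    have hall : ∀ s : Set I, MeasurableSet s → ∫ x in s, f x = 0 := by
      intro s hs
      induction s, hs using MeasurableSpace.induction_on_inter
        (borel_eq_generateFrom_Iic I ▸ (BorelSpace.measurable_eq (α := I))) isPiSystem_Iic with
      | empty => simp
      | basic u hu =>
        obtain ⟨t, rfl⟩ := hu
        rw [← hIic]; exact h0 t
      | compl u hu ih =>
        have h2 := integral_add_compl hu hint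
        have h3 : ∫ x, f x ∂(volume : Measure I) = 0 := by
          have h4 := h0 1
          rwa [hIic, show Set.Iic (1 : I) = Set.univ from Set.Iic_top, setIntegral_univ] at h4
        rw [ih, h3, zero_add] at h2
        exact h2
      | iUnion u hd hm ih =>
        rw [integral_iUnion hm hd hint.integrableOn]
        simp [ih]
    rw [Lp.eq_zero_iff_ae_eq_zero]
    exact hint.ae_eq_zero_of_forall_setIntegral_eq_zero fun s hs _ => hall s hs
  intro x
  have hx : x ∈ (LinearMap.range stepMap).topologicalClosure := key ▸ Submodule.mem_top
  simpa using! hx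

section WienerIntegral

variable {Ω : Type*} [MeasurableSpace Ω] {P : Measure Ω} {w : Ω → C(I, ℝ)}

lemma IsWienerProcess.hasLaw_eval (hw : IsWienerProcess P w) (t : I) :
    HasLaw (fun ω => w ω t) (gaussianReal 0 (t : ℝ).toNNReal) P := by
  have h := hw.law 0 t t.2.1
  rw [show ((0 : I) : ℝ) = 0 from rfl, sub_zero] at h
  refine h.congr ?_
  filter_upwards [hw.zero] with ω hω
  simp [hω]

lemma IsWienerProcess.memLp (hw : IsWienerProcess P w) (t : I) :
    MemLp (fun ω => w ω t) 2 P :=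
  (hw.hasLaw_eval t).hasGaussianLaw.memLp_two

/-- The value `w(t)` of a Wiener process as an element of `L₂(P)`. -/
def IsWienerProcess.evalLp (hw : IsWienerProcess P w) (t : I) : Lp ℝ 2 P :=
  (hw.memLp t).toLp

/-- The elementary integral, sending (the formal combination giving) the step function
`∑ cₜ 1_[0,t]` to the random variable `∑ cₜ w(t)`. -/
def IsWienerProcess.stepIntegral (hw : IsWienerProcess P w) : (I →₀ ℝ) →ₗ[ℝ] Lp ℝ 2 P :=
  Finsupp.linearCombination ℝ hw.evalLp

/-- The Wiener integral `φ ↦ ∫₀¹ φ dw`: the extension by continuity to `L₂([0,1])` of the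
elementary integral `∑ cₜ 1_[0,t] ↦ ∑ cₜ w(t)` on step functions. -/
def IsWienerProcess.wienerIntegral (hw : IsWienerProcess P w) : L2I →L[ℝ] Lp ℝ 2 P :=
  hw.stepIntegral.extendOfNorm stepMap

lemma IsWienerProcess.inner_evalLp (hw : IsWienerProcess P w) (s t : I) :
    ⟪hw.evalLp s, hw.evalLp t⟫_ℝ = min (s : ℝ) (t : ℝ) := by
  wlog hst : s ≤ t generalizing s t
  · rw [real_inner_comm, this t s (le_of_not_ge hst), min_comm]
  have hP : IsProbabilityMeasure P := (hw.hasLaw_eval 0).isProbabilityMeasure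
  have h0 : ∀ᵐ ω ∂P, (fun (t : I) (ω : Ω) => w ω t) ⊥ ω = 0 := hw.zero
  have hind := hw.indep.indepFun_eval_sub (bot_le : ⊥ ≤ s) hst h0
  have hcov : cov[fun ω => w ω s, fun ω => w ω t; P] = s := by
    have e : (fun ω => w ω t) = (fun ω => w ω t - w ω s) + fun ω => w ω s := by
      ext; simp
    have hz : cov[fun ω => w ω s, fun ω => w ω t - w ω s; P] = 0 :=
      hind.covariance_eq_zero (hw.memLp s) ((hw.memLp t).sub (hw.memLp s))
    have ha := covariance_add_right (hw.memLp s) ((hw.memLp t).sub (hw.memLp s)) (hw.memLp s)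
    rw [e]
    refine ha.trans ?_
    change cov[fun ω => w ω s, fun ω => w ω t - w ω s; P] + _ = _
    rw [hz, covariance_self (hw.hasLaw_eval s).aemeasurable, (hw.hasLaw_eval s).variance_eq,
      variance_id_gaussianReal]
    simp [s.2.1]
  have hm : ∀ u : I, P[fun ω => w ω u] = 0 := fun u => by
    rw [(hw.hasLaw_eval u).integral_eq, integral_id_gaussianReal]
  rw [covariance_eq_sub (hw.memLp s) (hw.memLp t), hm s, zero_mul, sub_zero] at hcov
  rw [min_eq_left (by exact_mod_cast hst), ← hcov, L2.inner_def]
  refine integral_congr_ae ?_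
  filter_upwards [(hw.memLp s).coeFn_toLp, (hw.memLp t).coeFn_toLp] with ω h1 h2
  simp [IsWienerProcess.evalLp, h1, h2, mul_comm]

/-- The elementary integral is isometric. -/
lemma IsWienerProcess.norm_stepIntegral (hw : IsWienerProcess P w) (c : I →₀ ℝ) :
    ‖hw.stepIntegral c‖ = ‖stepMap c‖ := by
  have h : ⟪hw.stepIntegral c, hw.stepIntegral c⟫_ℝ = ⟪stepMap c, stepMap c⟫_ℝ := by
    simp only [IsWienerProcess.stepIntegral, stepMap, Finsupp.linearCombination_apply,
      Finsupp.sum, sum_inner, inner_sum, inner_smul_left, inner_smul_right,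
      hw.inner_evalLp, inner_ind]
  rw [real_inner_self_eq_norm_sq, real_inner_self_eq_norm_sq] at h
  exact (sq_eq_sq₀ (norm_nonneg _) (norm_nonneg _)).1 h

/-- `∫₀¹ 1_[0,t] dw = w(t)`. -/
lemma IsWienerProcess.wienerIntegral_ind (hw : IsWienerProcess P w) (t : I) :
    hw.wienerIntegral (ind t) = hw.evalLp t := by
  have h := LinearMap.extendOfNorm_eq (f := hw.stepIntegral) denseRange_stepMap
    ⟨1, fun c => by rw [hw.norm_stepIntegral, one_mul]⟩ (Finsupp.single t 1)
  simpa [stepMap, IsWienerProcess.stepIntegral, IsWienerProcess.wienerIntegral] using h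

end WienerIntegral

/-! ### The operators `V`, `S` and the generalized random element `ξ` -/

section Operators

variable {Ω : Type*} [MeasurableSpace Ω] {P : Measure Ω} {w₁ w₂ : Ω → C(I, ℝ)}

/-- The cross-covariance operator `V` on `L₂([0,1])`, i.e. the unique bounded operator with
`E (∫ φ₁ dw₁) (∫ φ₂ dw₂) = ∫ φ₁ V φ₂ ds`, see `inner_crossCov`. -/
def crossCov (hw₁ : IsWienerProcess P w₁) (hw₂ : IsWienerProcess P w₂) : L2I →L[ℝ] L2I :=
  (ContinuousLinearMap.adjoint hw₁.wienerIntegral) ∘L hw₂.wienerIntegral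

lemma inner_crossCov (hw₁ : IsWienerProcess P w₁) (hw₂ : IsWienerProcess P w₂) (φ₁ φ₂ : L2I) :
    ∫ ω, hw₁.wienerIntegral φ₁ ω * hw₂.wienerIntegral φ₂ ω ∂P
      = ∫ s, φ₁ s * crossCov hw₁ hw₂ φ₂ s := by
  have h : ⟪φ₁, crossCov hw₁ hw₂ φ₂⟫_ℝ =
      ⟪hw₁.wienerIntegral φ₁, hw₂.wienerIntegral φ₂⟫_ℝ := by
    rw [crossCov, ContinuousLinearMap.comp_apply, ContinuousLinearMap.adjoint_inner_right]
  rw [L2.inner_def, L2.inner_def] at h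
  simp only [Real.inner_apply] at h
  exact h.symm

/-- The operator `S φ = (φ₁ + V φ₂, V* φ₁ + φ₂)` on `H` determined by an operator `V`. -/
def covOp (V : L2I →L[ℝ] L2I) : L2Pair →L[ℝ] L2Pair :=
  ((WithLp.prodContinuousLinearEquiv 2 ℝ L2I L2I).symm : L2I × L2I →L[ℝ] L2Pair) ∘L
    ((WithLp.fstL 2 ℝ L2I L2I + V ∘L WithLp.sndL 2 ℝ L2I L2I).prod
      (ContinuousLinearMap.adjoint V ∘L WithLp.fstL 2 ℝ L2I L2I + WithLp.sndL 2 ℝ L2I L2I))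

lemma covOp_apply (V : L2I →L[ℝ] L2I) (φ : L2Pair) :
    covOp V φ =
      WithLp.toLp 2 (φ.fst + V φ.snd, ContinuousLinearMap.adjoint V φ.fst + φ.snd) := rfl

/-- The generalized Gaussian random element `ξ` in `H`:
`(φ, ξ) = ∫ φ₁ dw₁ + ∫ φ₂ dw₂`, as an element of `L₂(P)`. -/
def xi (hw₁ : IsWienerProcess P w₁) (hw₂ : IsWienerProcess P w₂) (φ : L2Pair) : Lp ℝ 2 P :=
  hw₁.wienerIntegral φ.fst + hw₂.wienerIntegral φ.snd

end Operators

/-! ### Laws and shifts on `C([0,1]) ⊕ C([0,1])` -/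

/-- The primitive `t ↦ ∫₀ᵗ φ ds` of `φ ∈ L₂([0,1])`. -/
def primitive (φ : L2I) : C(I, ℝ) where
  toFun t := ∫ s in Set.Icc 0 t, φ s
  continuous_toFun := by
    have hint : Integrable φ (volume : Measure I) := (Lp.memLp φ).integrable (by norm_num)
    have e : ∀ t : I, ∫ s in Set.Icc 0 t, φ s = ∫ s, (Set.Iic t).indicator φ s := fun t => by
      rw [integral_indicator measurableSet_Iic]
      congr 2
      ext x; simp
    simp_rw [e]
    refine continuous_iff_continuousAt.2 fun t₀ => ?_
    refine continuousAt_of_dominated (bound := fun s => ‖φ s‖) ?_ ?_ hint.norm ?_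
    · exact .of_forall fun t => hint.aestronglyMeasurable.indicator measurableSet_Iic
    · exact .of_forall fun t => .of_forall fun s => norm_indicator_le_norm_self _ _
    · have hne : ∀ᵐ s ∂(volume : Measure I), s ≠ t₀ := by
        simp [ae_iff, measure_singleton]
      filter_upwards [hne] with s hs
      rcases lt_or_gt_of_ne hs with h | h
      · refine (continuousAt_const (y := φ s)).congr ?_
        filter_upwards [lt_mem_nhds h] with t ht
        simp [Set.indicator, ht.le]
      · refine (continuousAt_const (y := (0 : ℝ))).congr ?_
        filter_upwards [gt_mem_nhds h] with t ht
        simp [Set.indicator, not_le.2 ht]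

/-- The canonical embedding `i` of `H` into `C([0,1]) ⊕ C([0,1])`:
`i(φ)(t) = (∫₀ᵗ φ₁ ds, ∫₀ᵗ φ₂ ds)`. -/
def embed (φ : L2Pair) : C(I, ℝ) × C(I, ℝ) := (primitive φ.fst, primitive φ.snd)

/-- The law of the pair `(w₁, w₂)` on `C([0,1]) ⊕ C([0,1])`. -/
def pairLaw {Ω : Type*} [MeasurableSpace Ω] (P : Measure Ω) (w₁ w₂ : Ω → C(I, ℝ)) :
    Measure (C(I, ℝ) × C(I, ℝ)) :=
  P.map fun ω => (w₁ ω, w₂ ω)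

/-- The measure `μ` shifted by the vector `a`, i.e. the image of `μ` under `x ↦ x + a`. -/
def shift {E : Type*} [MeasurableSpace E] [Add E] (μ : Measure E) (a : E) : Measure E :=
  μ.map fun x => x + a

/-- The vector `a` is an admissible shift for `μ`: the shifted measure is absolutely continuous
with respect to `μ`. -/
def IsAdmissibleShift {E : Type*} [MeasurableSpace E] [Add E] (μ : Measure E) (a : E) : Prop :=
  shift μ a ≪ μ

end CorrelatedWiener

end

open CorrelatedWiener

namespace CorrelatedWiener

/-! ### Isometry and centering of the Wiener integral -/

section WienerIntegral

variable {Ω : Type*} [MeasurableSpace Ω] {P : Measure Ω} {w : Ω → C(I, ℝ)}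

/-! This is the Cameron–Martin argument for the centered Gaussian element `ξ`, whose covariance is
`S` (`inner_xi`). Since `S` differs from the identity by an operator of norm at most `‖V‖ < 1`, it
is invertible, so one may write `h = Sγ`; the claimed density is then `exp((γ, ξ) - (γ, Sγ)/2)`.

Weighting a Gaussian law by this exponential moves its mean: `(φ, ξ)` acquires mean `(φ, Sγ) = (φ,
h)` and keeps its variance (`integral_exp_xi_mul_exp_xi`). On paths, translation by `i(h)` has the
same effect, because a finite combination of path values changes by `(φ, h)`, with `φ` the
corresponding pair of step functions (`evalPairing_embed`). So the shifted and the weighted law have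
equal Fourier transforms on finite combinations of path values, and these determine a finite measure
(`ext_of_integral_exp_evalPairing`).

The density must be a function of the path, whereas `(γ, ξ)` is only an `L₂(P)` class on `Ω`;
`exists_xi_eq_comp` supplies a measurable version on path space. -/

lemma IsWienerProcess.wienerIntegral_stepMap (hw : IsWienerProcess P w) (c : I →₀ ℝ) :
    hw.wienerIntegral (stepMap c) = hw.stepIntegral c :=
  LinearMap.extendOfNorm_eq (f := hw.stepIntegral) denseRange_stepMap
    ⟨1, fun c => by rw [hw.norm_stepIntegral, one_mul]⟩ c

lemma IsWienerProcess.norm_wienerIntegral (hw : IsWienerProcess P w) (φ : L2I) :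
    ‖hw.wienerIntegral φ‖ = ‖φ‖ := by
  refine denseRange_stepMap.induction_on φ (isClosed_eq (by fun_prop) (by fun_prop)) fun c => ?_
  rw [hw.wienerIntegral_stepMap, hw.norm_stepIntegral]

lemma IsWienerProcess.inner_wienerIntegral (hw : IsWienerProcess P w) (φ ψ : L2I) :
    ⟪hw.wienerIntegral φ, hw.wienerIntegral ψ⟫_ℝ = ⟪φ, ψ⟫_ℝ :=
  LinearIsometry.inner_map_map ⟨hw.wienerIntegral.toLinearMap, hw.norm_wienerIntegral⟩ φ ψ

/-- The elementary integral is the corresponding linear combination of values of `w`. -/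
lemma IsWienerProcess.coeFn_stepIntegral (hw : IsWienerProcess P w) (c : I →₀ ℝ) :
    hw.stepIntegral c =ᵐ[P] fun ω => c.sum fun t a => a * w ω t := by
  rw [IsWienerProcess.stepIntegral, Finsupp.linearCombination_apply, Finsupp.sum]
  have h1 : ∀ t ∈ c.support, (c t • hw.evalLp t : Lp ℝ 2 P) =ᵐ[P] fun ω => c t * w ω t := by
    intro t _
    filter_upwards [Lp.coeFn_smul (c t) (hw.evalLp t), (hw.memLp t).coeFn_toLp] with ω h2 h3
    rw [h2, Pi.smul_apply, IsWienerProcess.evalLp, h3, smul_eq_mul]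
  filter_upwards [Lp.coeFn_finsetSum c.support fun t => c t • hw.evalLp t,
    (Finset.eventually_all _).2 h1] with ω h2 h3
  rw [h2, Finset.sum_apply, Finsupp.sum]
  exact Finset.sum_congr rfl h3

lemma IsWienerProcess.integral_wienerIntegral [IsProbabilityMeasure P]
    (hw : IsWienerProcess P w) (φ : L2I) : ∫ ω, hw.wienerIntegral φ ω ∂P = 0 := by
  -- The mean is the inner product with the constant `1`, hence continuous on `L₂(P)`, so it is
  -- enough to treat step functions.
  have e : ∀ f : Lp ℝ 2 P,
      ∫ ω, f ω ∂P = ⟪indicatorConstLp 2 MeasurableSet.univ (measure_ne_top P _) (1 : ℝ), f⟫_ℝ := by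
    intro f
    rw [L2.inner_indicatorConstLp_one, setIntegral_univ]
  rw [e]
  refine denseRange_stepMap.induction_on φ (isClosed_eq (by fun_prop) (by fun_prop)) fun c => ?_
  rw [hw.wienerIntegral_stepMap, ← e, integral_congr_ae (hw.coeFn_stepIntegral c)]
  simp only [Finsupp.sum]
  rw [integral_finsetSum _ fun t _ => ((hw.memLp t).integrable (by norm_num)).const_mul _]
  refine Finset.sum_eq_zero fun t _ => ?_
  rw [integral_const_mul, (hw.hasLaw_eval t).integral_eq, integral_id_gaussianReal, mul_zero]

end WienerIntegral

/-! ### The operator `S` -/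

/-- `S` is a perturbation of the identity of norm at most `‖V‖`. -/
lemma norm_covOp_sub_one_le (V : L2I →L[ℝ] L2I) : ‖covOp V - 1‖ ≤ ‖V‖ := by
  refine ContinuousLinearMap.opNorm_le_bound _ (norm_nonneg _) fun φ => ?_
  have e : (covOp V - 1) φ =
      WithLp.toLp 2 (V φ.snd, ContinuousLinearMap.adjoint V φ.fst) := by
    rw [sub_apply, covOp_apply, one_apply_eq_self]
    apply WithLp.ofLp_injective
    ext1 <;> simp
  have h1 := V.le_opNorm φ.snd
  have h2 := (ContinuousLinearMap.adjoint V).le_opNorm φ.fst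
  -- The adjoint has the same norm as `V`, so both components obey the same bound.
  rw [LinearIsometryEquiv.norm_map] at h2
  refine le_of_sq_le_sq ?_ (by positivity)
  rw [e, mul_pow, WithLp.prod_norm_sq_eq_of_L2, WithLp.prod_norm_sq_eq_of_L2]
  have h3 := pow_le_pow_left₀ (norm_nonneg _) h1 2
  have h4 := pow_le_pow_left₀ (norm_nonneg _) h2 2
  rw [mul_pow] at h3 h4
  change ‖V φ.snd‖ ^ 2 + ‖ContinuousLinearMap.adjoint V φ.fst‖ ^ 2 ≤ _
  linarith

/-- Neumann series for `1 - (1 - S)`. -/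
lemma isInvertible_covOp {V : L2I →L[ℝ] L2I} (hV : ‖V‖ < 1) : (covOp V).IsInvertible := by
  have h : IsUnit (1 - (1 - covOp V)) := by
    refine isUnit_one_sub_of_norm_lt_one ?_
    rw [norm_sub_rev]
    exact (norm_covOp_sub_one_le V).trans_lt hV
  rw [sub_sub_cancel] at h
  obtain ⟨u, hu⟩ := h
  exact ⟨ContinuousLinearEquiv.unitsEquiv _ _ u, hu⟩

/-! ### The random element `ξ` -/

section Xi

variable {Ω : Type*} [MeasurableSpace Ω] {P : Measure Ω} {w₁ w₂ : Ω → C(I, ℝ)}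
  (hw₁ : IsWienerProcess P w₁) (hw₂ : IsWienerProcess P w₂)

lemma xi_add (φ ψ : L2Pair) : xi hw₁ hw₂ (φ + ψ) = xi hw₁ hw₂ φ + xi hw₁ hw₂ ψ := by
  simp only [xi, WithLp.add_fst, WithLp.add_snd, map_add]
  abel

lemma xi_smul (a : ℝ) (φ : L2Pair) : xi hw₁ hw₂ (a • φ) = a • xi hw₁ hw₂ φ := by
  simp only [xi, WithLp.smul_fst, WithLp.smul_snd, map_smul, smul_add]

lemma continuous_xi : Continuous (xi hw₁ hw₂) := by
  unfold xi
  exact (hw₁.wienerIntegral.continuous.comp (WithLp.fstL 2 ℝ L2I L2I).continuous).add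
    (hw₂.wienerIntegral.continuous.comp (WithLp.sndL 2 ℝ L2I L2I).continuous)

/-- The covariance of `ξ` is `S`. -/
lemma inner_xi (φ ψ : L2Pair) :
    ⟪xi hw₁ hw₂ φ, xi hw₁ hw₂ ψ⟫_ℝ = ⟪φ, covOp (crossCov hw₁ hw₂) ψ⟫_ℝ := by
  rw [covOp_apply, WithLp.prod_inner_apply, xi, xi]
  simp only [inner_add_left, inner_add_right, hw₁.inner_wienerIntegral,
    hw₂.inner_wienerIntegral]
  have h1 : ⟪hw₁.wienerIntegral φ.fst, hw₂.wienerIntegral ψ.snd⟫_ℝ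
      = ⟪φ.fst, crossCov hw₁ hw₂ ψ.snd⟫_ℝ := by
    rw [crossCov, ContinuousLinearMap.comp_apply, ContinuousLinearMap.adjoint_inner_right]
  have h2 : ⟪hw₂.wienerIntegral φ.snd, hw₁.wienerIntegral ψ.fst⟫_ℝ
      = ⟪φ.snd, ContinuousLinearMap.adjoint (crossCov hw₁ hw₂) ψ.fst⟫_ℝ := by
    rw [ContinuousLinearMap.adjoint_inner_right, crossCov, ContinuousLinearMap.comp_apply,
      ContinuousLinearMap.adjoint_inner_left]
  rw [h1, h2]
  simp only [WithLp.fst, WithLp.snd]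
  ring

lemma integral_xi [IsProbabilityMeasure P] (φ : L2Pair) : ∫ ω, xi hw₁ hw₂ φ ω ∂P = 0 := by
  rw [xi, integral_congr_ae (Lp.coeFn_add _ _)]
  simp only [Pi.add_apply]
  rw [integral_add ((Lp.memLp _).integrable (by norm_num))
    ((Lp.memLp _).integrable (by norm_num)), hw₁.integral_wienerIntegral,
    hw₂.integral_wienerIntegral, add_zero]

/-- The pair of step functions with coefficients `c`. -/
noncomputable def stepPair (c : (I →₀ ℝ) × (I →₀ ℝ)) : L2Pair :=
  WithLp.toLp 2 (stepMap c.1, stepMap c.2)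

lemma denseRange_stepPair : DenseRange stepPair :=
  (WithLp.prodContinuousLinearEquiv 2 ℝ L2I L2I).symm.surjective.denseRange.comp
    (denseRange_stepMap.prodMap denseRange_stepMap)
    (WithLp.prodContinuousLinearEquiv 2 ℝ L2I L2I).symm.continuous

/-- The pairing of `C([0,1]) ⊕ C([0,1])` with pairs of finitely supported signed measures. -/
noncomputable def evalPairing :
    C(I, ℝ) × C(I, ℝ) →ₗ[ℝ] (I →₀ ℝ) × (I →₀ ℝ) →ₗ[ℝ] ℝ :=
  LinearMap.mk₂ ℝ
    (fun x c => (c.1.sum fun t a => a * x.1 t) + c.2.sum fun t a => a * x.2 t)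
    (fun x y c => by
      simp only [Prod.fst_add, Prod.snd_add, ContinuousMap.add_apply, mul_add, Finsupp.sum_add]
      ring)
    (fun a x c => by
      simp only [Prod.smul_fst, Prod.smul_snd, ContinuousMap.smul_apply, smul_eq_mul, mul_add,
        Finsupp.mul_sum, mul_left_comm])
    (fun x c d => by
      simp only [Prod.fst_add, Prod.snd_add]
      rw [Finsupp.sum_add_index' (by simp) (by intros; ring),
        Finsupp.sum_add_index' (by simp) (by intros; ring)]
      ring)
    (fun a x c => by
      simp only [Prod.smul_fst, Prod.smul_snd]
      rw [Finsupp.sum_smul_index (by simp), Finsupp.sum_smul_index (by simp)]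
      simp only [smul_eq_mul, mul_add, Finsupp.mul_sum, mul_assoc])

lemma evalPairing_apply (x : C(I, ℝ) × C(I, ℝ)) (c : (I →₀ ℝ) × (I →₀ ℝ)) :
    evalPairing x c = (c.1.sum fun t a => a * x.1 t) + c.2.sum fun t a => a * x.2 t := rfl

lemma continuous_evalPairing (c : (I →₀ ℝ) × (I →₀ ℝ)) :
    Continuous fun x => evalPairing x c := by
  simp only [evalPairing_apply, Finsupp.sum]
  fun_prop

/-- Point evaluations separate continuous paths; this is what lets the Fourier transform along these
functionals determine a measure. -/
lemma evalPairing_ne_zero {x : C(I, ℝ) × C(I, ℝ)} (hx : x ≠ 0) : evalPairing x ≠ 0 := by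
  contrapose! hx
  ext t
  · simpa [evalPairing_apply] using LinearMap.congr_fun hx (Finsupp.single t 1, 0)
  · simpa [evalPairing_apply] using LinearMap.congr_fun hx (0, Finsupp.single t 1)

/-- The embedding is dual to the step map, since `∫₀ᵗ φ = (1_[0,t], φ)`. Translation by `embed h`
thus becomes a phase factor in the Fourier transform. -/
lemma evalPairing_embed (h : L2Pair) (c : (I →₀ ℝ) × (I →₀ ℝ)) :
    evalPairing (embed h) c = ⟪stepPair c, h⟫_ℝ := by
  have key : ∀ (c : I →₀ ℝ) (φ : L2I),
      (c.sum fun t a => a * primitive φ t) = ⟪stepMap c, φ⟫_ℝ := by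
    intro c φ
    rw [stepMap, Finsupp.linearCombination_apply, Finsupp.sum, Finsupp.sum, sum_inner]
    refine Finset.sum_congr rfl fun t _ => ?_
    rw [real_inner_smul_left, ind, L2.inner_indicatorConstLp_one]
    rfl
  rw [evalPairing_apply, embed, key, key, WithLp.prod_inner_apply]
  rfl

/-- The link between `ξ` and the paths: on the dense set of step pairs, `ξ` is an explicit
continuous functional of `(w₁, w₂)`. -/
lemma coeFn_xi_stepPair (c : (I →₀ ℝ) × (I →₀ ℝ)) :
    xi hw₁ hw₂ (stepPair c) =ᵐ[P] fun ω => evalPairing (w₁ ω, w₂ ω) c := by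
  have e : xi hw₁ hw₂ (stepPair c) = hw₁.stepIntegral c.1 + hw₂.stepIntegral c.2 := by
    rw [← hw₁.wienerIntegral_stepMap, ← hw₂.wienerIntegral_stepMap]
    rfl
  rw [e]
  filter_upwards [Lp.coeFn_add (hw₁.stepIntegral c.1) (hw₂.stepIntegral c.2),
    hw₁.coeFn_stepIntegral c.1, hw₂.coeFn_stepIntegral c.2] with ω h1 h2 h3
  rw [h1, Pi.add_apply, h2, h3, evalPairing_apply]

end Xi

/-! ### Gaussianity of `ξ` -/

/-- The characteristic function at `1` is `1`-Lipschitz on `L₂`. -/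
lemma norm_integral_exp_sub_le {Ω : Type*} [MeasurableSpace Ω] {P : Measure Ω}
    [IsProbabilityMeasure P] (f g : Lp ℝ 2 P) :
    ‖(∫ ω, Complex.exp (Complex.I * f ω) ∂P) - ∫ ω, Complex.exp (Complex.I * g ω) ∂P‖
      ≤ ‖f - g‖ := by
  have hi : ∀ f : Lp ℝ 2 P, Integrable (fun ω => Complex.exp (Complex.I * f ω)) P := by
    intro f
    refine Integrable.of_bound (C := 1) ?_ (.of_forall fun ω => ?_)
    · have := (Lp.stronglyMeasurable f).measurable
      exact Measurable.aestronglyMeasurable (by fun_prop)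
    · rw [mul_comm, Complex.norm_exp_ofReal_mul_I]
  have hfg : Integrable (fun ω => ‖(f - g : Lp ℝ 2 P) ω‖) P :=
    ((Lp.memLp (f - g)).integrable (by norm_num)).norm
  rw [← integral_sub (hi f) (hi g)]
  calc ‖∫ ω, (Complex.exp (Complex.I * f ω) - Complex.exp (Complex.I * g ω)) ∂P‖
      ≤ ∫ ω, ‖(f - g : Lp ℝ 2 P) ω‖ ∂P := by
        refine norm_integral_le_of_norm_le hfg ?_
        filter_upwards [Lp.coeFn_sub f g] with ω h
        rw [h, Pi.sub_apply]
        -- A unimodular factor is pulled out, leaving `|exp(ix) - 1| ≤ |x|`; the `L₁` norm is then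
        -- at most the `L₂` norm because `P` is a probability measure.
        have e : Complex.exp (Complex.I * f ω) - Complex.exp (Complex.I * g ω)
            = Complex.exp (g ω * Complex.I)
              * (Complex.exp (Complex.I * ((f ω - g ω : ℝ) : ℂ)) - 1) := by
          rw [mul_sub, ← Complex.exp_add, mul_one]
          push_cast
          ring_nf
        rw [e, norm_mul, Complex.norm_exp_ofReal_mul_I, one_mul]
        exact Real.norm_exp_I_mul_ofReal_sub_one_le
    _ ≤ ‖f - g‖ := by
        rw [integral_norm_eq_lintegral_enorm (Lp.aestronglyMeasurable _),
          ← eLpNorm_one_eq_lintegral_enorm, Lp.norm_def]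
        exact ENNReal.toReal_mono (Lp.eLpNorm_ne_top _)
          (eLpNorm_le_eLpNorm_of_exponent_le (by norm_num) (Lp.aestronglyMeasurable _))

section Gaussian

variable {Ω : Type*} [MeasurableSpace Ω] {P : Measure Ω} {w₁ w₂ : Ω → C(I, ℝ)}
  (hw₁ : IsWienerProcess P w₁) (hw₂ : IsWienerProcess P w₂)

lemma variance_xi [IsProbabilityMeasure P] (φ : L2Pair) :
    Var[xi hw₁ hw₂ φ; P] = ⟪φ, covOp (crossCov hw₁ hw₂) φ⟫_ℝ := by
  rw [variance_of_integral_eq_zero (Lp.aestronglyMeasurable _).aemeasurable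
    (integral_xi hw₁ hw₂ φ), ← inner_xi, L2.inner_def]
  refine integral_congr_ae (.of_forall fun ω => ?_)
  simp [sq]

lemma covariance_xi [IsProbabilityMeasure P] (φ ψ : L2Pair) :
    cov[xi hw₁ hw₂ φ, xi hw₁ hw₂ ψ; P] = ⟪φ, covOp (crossCov hw₁ hw₂) ψ⟫_ℝ := by
  rw [covariance_eq_sub (Lp.memLp _) (Lp.memLp _), integral_xi, integral_xi, mul_zero, sub_zero,
    ← inner_xi, L2.inner_def]
  refine integral_congr_ae (.of_forall fun ω => ?_)
  simp [mul_comm]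

lemma inner_covOp_self_nonneg (φ : L2Pair) : 0 ≤ ⟪φ, covOp (crossCov hw₁ hw₂) φ⟫_ℝ := by
  rw [← inner_xi]
  exact real_inner_self_nonneg

lemma hasGaussianLaw_evalPairing (hG : JointlyGaussian P w₁ w₂)
    (c : (I →₀ ℝ) × (I →₀ ℝ)) :
    HasGaussianLaw (fun ω => evalPairing (w₁ ω, w₂ ω) c) P := by
  -- Only finitely many values of the joint process enter: times of `w₁` on the left, of `w₂` on the
  -- right.
  let J : Finset (I ⊕ I) := c.1.support.disjSum c.2.support
  let l : (J → ℝ) →L[ℝ] ℝ :=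
    ∑ s : J, (Sum.elim c.1 c.2 s.1) • ContinuousLinearMap.proj (R := ℝ) (φ := fun _ : J => ℝ) s
  convert! (hG.hasGaussianLaw J).map_fun l using 2
  simp only [l, sum_apply, smul_apply, ContinuousLinearMap.proj_apply, smul_eq_mul,
    Finset.restrict]
  rw [Finset.sum_coe_sort J fun s => Sum.elim c.1 c.2 s
    * Sum.elim (fun (t : I) (ω : Ω) => w₁ ω t) (fun (t : I) (ω : Ω) => w₂ ω t) s _,
    Finset.sum_disjSum]
  rfl

/-- Both sides are continuous in `φ`, and for step pairs the random variable is a finite combination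
of jointly Gaussian values. -/
lemma integral_exp_xi [IsProbabilityMeasure P] (hG : JointlyGaussian P w₁ w₂) (φ : L2Pair) :
    ∫ ω, Complex.exp (Complex.I * xi hw₁ hw₂ φ ω) ∂P
      = Complex.exp (-(⟪φ, covOp (crossCov hw₁ hw₂) φ⟫_ℝ : ℝ) / 2) := by
  have hcont : Continuous fun f : Lp ℝ 2 P => ∫ ω, Complex.exp (Complex.I * f ω) ∂P :=
    LipschitzWith.continuous (K := 1) (LipschitzWith.of_dist_le_mul fun f g => by
      rw [dist_eq_norm, dist_eq_norm, NNReal.coe_one, one_mul]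
      exact norm_integral_exp_sub_le f g)
  refine denseRange_stepPair.induction_on φ
    (isClosed_eq (hcont.comp (continuous_xi hw₁ hw₂)) (by fun_prop)) fun c => ?_
  have hlaw : HasGaussianLaw (xi hw₁ hw₂ (stepPair c)) P :=
    (hasGaussianLaw_evalPairing hG c).congr (coeFn_xi_stepPair hw₁ hw₂ c).symm
  have hmgf := complexMGF_gaussianReal hlaw.map_eq_gaussianReal Complex.I
  rw [integral_xi, variance_xi, complexMGF] at hmgf
  rw [hmgf, Real.coe_toNNReal _ (inner_covOp_self_nonneg hw₁ hw₂ _)]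
  congr 1
  simp

/-- `(φ, ξ)` is centered Gaussian with variance `(φ, Sφ)`. -/
lemma map_xi [IsProbabilityMeasure P] (hG : JointlyGaussian P w₁ w₂) (φ : L2Pair) :
    P.map (xi hw₁ hw₂ φ) = gaussianReal 0 (⟪φ, covOp (crossCov hw₁ hw₂) φ⟫_ℝ).toNNReal := by
  have : IsProbabilityMeasure (P.map (xi hw₁ hw₂ φ)) :=
    Measure.isProbabilityMeasure_map (Lp.aestronglyMeasurable _).aemeasurable
  refine Measure.ext_of_charFun ?_
  ext t
  rw [charFun_gaussianReal, charFun_apply_real,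
    integral_map (Lp.aestronglyMeasurable _).aemeasurable (by fun_prop)]
  -- By linearity of `ξ`, the characteristic function of `(φ, ξ)` at `t` is the one of `(tφ, ξ)` at
  -- `1`.
  have h := integral_exp_xi hw₁ hw₂ hG (t • φ)
  rw [xi_smul, map_smul, inner_smul_left, inner_smul_right] at h
  rw [Real.coe_toNNReal _ (inner_covOp_self_nonneg hw₁ hw₂ _)]
  convert h using 1
  · refine integral_congr_ae ?_
    filter_upwards [Lp.coeFn_smul t (xi hw₁ hw₂ φ)] with ω hω
    rw [hω, Pi.smul_apply, smul_eq_mul]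
    push_cast
    ring_nf
  · simp
    ring_nf

/-- Every linear functional of the pair is again some `(χ, ξ)`, hence Gaussian. Joint Gaussianity is
what turns zero covariance into independence below. -/
lemma hasGaussianLaw_xi_prodMk [IsProbabilityMeasure P] (hG : JointlyGaussian P w₁ w₂)
    (φ ψ : L2Pair) : HasGaussianLaw (fun ω => (xi hw₁ hw₂ φ ω, xi hw₁ hw₂ ψ ω)) P where
  isGaussian_map := by
    have hm : ∀ φ, Measurable (xi hw₁ hw₂ φ) := fun φ => (Lp.stronglyMeasurable _).measurable
    refine isGaussian_of_map_eq_gaussianReal fun l =>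
      ⟨_, _, Eq.trans ?_ (map_xi hw₁ hw₂ hG (l (1, 0) • φ + l (0, 1) • ψ))⟩
    rw [Measure.map_map (by fun_prop) ((hm φ).prodMk (hm ψ))]
    refine Measure.map_congr ?_
    rw [xi_add, xi_smul, xi_smul]
    filter_upwards [Lp.coeFn_add (l (1, 0) • xi hw₁ hw₂ φ) (l (0, 1) • xi hw₁ hw₂ ψ),
      Lp.coeFn_smul (l (1, 0)) (xi hw₁ hw₂ φ), Lp.coeFn_smul (l (0, 1)) (xi hw₁ hw₂ ψ)]
      with ω h1 h2 h3
    rw [h1, Pi.add_apply, h2, h3, Function.comp_apply]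
    have e : (xi hw₁ hw₂ φ ω, xi hw₁ hw₂ ψ ω)
        = xi hw₁ hw₂ φ ω • ((1 : ℝ), (0 : ℝ)) + xi hw₁ hw₂ ψ ω • ((0 : ℝ), (1 : ℝ)) := by
      simp
    rw [e, map_add, map_smul, map_smul]
    simp [mul_comm]

lemma integrable_exp_xi [IsProbabilityMeasure P] (hG : JointlyGaussian P w₁ w₂) (φ : L2Pair) :
    Integrable (fun ω => Real.exp (xi hw₁ hw₂ φ ω)) P := by
  have h := integrable_exp_mul_gaussianReal (μ := 0)
    (v := (⟪φ, covOp (crossCov hw₁ hw₂) φ⟫_ℝ).toNNReal) 1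
  rw [← map_xi hw₁ hw₂ hG φ] at h
  simpa [Function.comp_def] using h.comp_aemeasurable (Lp.aestronglyMeasurable _).aemeasurable

/-- The Fourier transform of the Gaussian law tilted by `(γ, ξ)`. -/
lemma integral_exp_xi_mul_exp_xi [IsProbabilityMeasure P] (hG : JointlyGaussian P w₁ w₂)
    (φ γ : L2Pair) :
    ∫ ω, Complex.exp (xi hw₁ hw₂ γ ω) * Complex.exp (Complex.I * xi hw₁ hw₂ φ ω) ∂P
      = Complex.exp ((⟪γ, covOp (crossCov hw₁ hw₂) γ⟫_ℝ : ℝ) / 2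
          + Complex.I * (⟪φ, covOp (crossCov hw₁ hw₂) γ⟫_ℝ : ℝ)
          - (⟪φ, covOp (crossCov hw₁ hw₂) φ⟫_ℝ : ℝ) / 2) := by
  set S := covOp (crossCov hw₁ hw₂) with hS
  have hsymm : ∀ φ ψ, ⟪φ, S ψ⟫_ℝ = ⟪ψ, S φ⟫_ℝ := fun φ ψ => by
    rw [← inner_xi, ← inner_xi, real_inner_comm]
  -- `a` is the regression coefficient of `(φ, ξ)` on `(γ, ξ)`. If `(γ, ξ)` has zero variance it
  -- vanishes, and `a = 0` serves.
  obtain ⟨a, ha⟩ : ∃ a : ℝ, ⟪φ, S γ⟫_ℝ = a * ⟪γ, S γ⟫_ℝ := by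
    by_cases h0 : ⟪γ, S γ⟫_ℝ = 0
    · refine ⟨0, ?_⟩
      have h1 : xi hw₁ hw₂ γ = 0 := by
        rwa [← inner_xi, inner_self_eq_zero] at h0
      rw [← inner_xi, h1, inner_zero_right, zero_mul]
    · exact ⟨⟪φ, S γ⟫_ℝ / ⟪γ, S γ⟫_ℝ, by field_simp⟩
  -- The regression residual: `(ψ, ξ)` is uncorrelated with `(γ, ξ)`, hence independent of it.
  set ψ : L2Pair := φ + (-a) • γ with hψ
  have hcov : cov[xi hw₁ hw₂ γ, xi hw₁ hw₂ ψ; P] = 0 := by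
    rw [covariance_xi, ← hS, hsymm, hψ, inner_add_left, real_inner_smul_left, ha]
    ring
  have hvar : ⟪ψ, S ψ⟫_ℝ = ⟪φ, S φ⟫_ℝ - a ^ 2 * ⟪γ, S γ⟫_ℝ := by
    rw [hψ, map_add, map_smul, inner_add_left, inner_add_right, inner_add_right,
      real_inner_smul_left, real_inner_smul_left, real_inner_smul_right, real_inner_smul_right,
      hsymm γ φ, ha]
    ring
  have hind : IndepFun (xi hw₁ hw₂ γ) (xi hw₁ hw₂ ψ) P :=
    (hasGaussianLaw_xi_prodMk hw₁ hw₂ hG γ ψ).indepFun_of_covariance_eq_zero hcov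
  -- The integrand factors as `exp((1 + ia)(γ, ξ)) · exp(i(ψ, ξ))`, so the expectation is a Gaussian
  -- moment generating function at `1 + ia` times a characteristic function.
  have hmul := hind.integral_fun_comp_mul_comp (𝕜 := ℂ)
    (f := fun x : ℝ => Complex.exp ((1 + a * Complex.I) * x))
    (g := fun x : ℝ => Complex.exp (Complex.I * x))
    (Lp.aestronglyMeasurable _).aemeasurable (Lp.aestronglyMeasurable _).aemeasurable
    (by fun_prop) (by fun_prop)
  have hmgf := complexMGF_gaussianReal (map_xi hw₁ hw₂ hG γ) (1 + a * Complex.I)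
  rw [complexMGF] at hmgf
  rw [integral_exp_xi hw₁ hw₂ hG, hmgf, ← hS, hvar, ← Complex.exp_add,
    Real.coe_toNNReal _ (inner_covOp_self_nonneg hw₁ hw₂ _), ← hS] at hmul
  convert hmul using 1
  · refine integral_congr_ae ?_
    rw [hψ, xi_add, xi_smul]
    filter_upwards [Lp.coeFn_add (xi hw₁ hw₂ φ) ((-a) • xi hw₁ hw₂ γ),
      Lp.coeFn_smul (-a) (xi hw₁ hw₂ γ)] with ω h1 h2
    rw [h1, Pi.add_apply, h2, Pi.smul_apply, smul_eq_mul, ← Complex.exp_add, ← Complex.exp_add]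
    congr 1
    push_cast
    ring
  · rw [ha]
    congr 1
    push_cast
    ring_nf
    simp only [Complex.I_sq]
    ring

end Gaussian

/-! ### The density of the shifted law -/

section Density

variable {Ω : Type*} [MeasurableSpace Ω] {P : Measure Ω} {w₁ w₂ : Ω → C(I, ℝ)}
  (hw₁ : IsWienerProcess P w₁) (hw₂ : IsWienerProcess P w₂)

lemma measurePreserving_pair (hw₁ : IsWienerProcess P w₁) (hw₂ : IsWienerProcess P w₂) :
    MeasurePreserving (fun ω => (w₁ ω, w₂ ω)) P (pairLaw P w₁ w₂) :=
  ⟨hw₁.measurable.prodMk hw₂.measurable, rfl⟩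

/-- `(φ, ξ)` is a measurable function of `(w₁, w₂)`. -/
lemma exists_xi_eq_comp (φ : L2Pair) :
    ∃ F : C(I, ℝ) × C(I, ℝ) → ℝ, Measurable F ∧
      xi hw₁ hw₂ φ =ᵐ[P] fun ω => F (w₁ ω, w₂ ω) := by
  have hX := measurePreserving_pair hw₁ hw₂
  -- Composition with the path map is an isometry of `L₂` spaces, so its range is closed; the step
  -- pairs then suffice.
  suffices h : xi hw₁ hw₂ φ ∈
      Set.range (Lp.compMeasurePreserving (E := ℝ) (p := 2) (fun ω => (w₁ ω, w₂ ω)) hX) by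
    obtain ⟨F, hF⟩ := h
    refine ⟨F, (Lp.stronglyMeasurable F).measurable, ?_⟩
    rw [← hF]
    exact Lp.coeFn_compMeasurePreserving F hX
  refine denseRange_stepPair.induction_on φ
    ((Lp.isometry_compMeasurePreserving hX).isClosedEmbedding.isClosed_range.preimage
      (continuous_xi hw₁ hw₂)) fun c => ?_
  have hmeas : AEStronglyMeasurable (fun x => evalPairing x c) (pairLaw P w₁ w₂) :=
    (continuous_evalPairing c).measurable.aestronglyMeasurable
  have hc : MemLp (fun x => evalPairing x c) 2 (pairLaw P w₁ w₂) := by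
    rw [← hX.map_eq] at hmeas ⊢
    rw [memLp_map_measure_iff hmeas hX.measurable.aemeasurable]
    exact (memLp_congr_ae (coeFn_xi_stepPair hw₁ hw₂ c)).1 (Lp.memLp _)
  refine ⟨hc.toLp, ?_⟩
  rw [Lp.toLp_compMeasurePreserving]
  refine Lp.ext ?_
  filter_upwards [(hc.comp_measurePreserving hX).coeFn_toLp, coeFn_xi_stepPair hw₁ hw₂ c]
    with ω h1 h2
  rw [h1, h2, Function.comp_apply]

/-- Two finite measures on `C([0,1]) ⊕ C([0,1])` agree if the Fourier transforms of their
finite-dimensional distributions do. -/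
lemma ext_of_integral_exp_evalPairing {μ ν : Measure (C(I, ℝ) × C(I, ℝ))} [IsFiniteMeasure μ]
    [IsFiniteMeasure ν]
    (h : ∀ c, ∫ x, Complex.exp (Complex.I * (evalPairing x c : ℝ)) ∂μ
      = ∫ x, Complex.exp (Complex.I * (evalPairing x c : ℝ)) ∂ν) : μ = ν := by
  -- With the discrete topology on the functionals, joint continuity of the pairing reduces to
  -- continuity in the path.
  let _ : TopologicalSpace ((I →₀ ℝ) × (I →₀ ℝ)) := ⊥
  have : DiscreteTopology ((I →₀ ℝ) × (I →₀ ℝ)) := ⟨rfl⟩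
  have hL : Continuous fun p : (C(I, ℝ) × C(I, ℝ)) × ((I →₀ ℝ) × (I →₀ ℝ)) =>
      evalPairing p.1 p.2 :=
    continuous_prod_of_discrete_right.2 continuous_evalPairing
  refine ext_of_integral_char_eq Real.continuous_probChar
    Real.probChar_ne_one (fun x hx => evalPairing_ne_zero hx) hL fun c => ?_
  simpa [BoundedContinuousFunction.char_apply, Real.probChar_apply,
    mul_comm] using h c

/-- The shifted law has density `exp ((γ, ξ) - (γ, Sγ) / 2)`, where `h = Sγ`. -/
lemma shift_pairLaw_eq_withDensity [IsProbabilityMeasure P] (hG : JointlyGaussian P w₁ w₂)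
    (γ : L2Pair) {F : C(I, ℝ) × C(I, ℝ) → ℝ} (hF : Measurable F)
    (hγ : xi hw₁ hw₂ γ =ᵐ[P] fun ω => F (w₁ ω, w₂ ω)) :
    shift (pairLaw P w₁ w₂) (embed (covOp (crossCov hw₁ hw₂) γ))
      = (pairLaw P w₁ w₂).withDensity fun x => ENNReal.ofReal
          (Real.exp (F x - 1 / 2 * ⟪γ, covOp (crossCov hw₁ hw₂) γ⟫_ℝ)) := by
  set S := covOp (crossCov hw₁ hw₂) with hS
  have hX := measurePreserving_pair hw₁ hw₂
  have hXm := hX.measurable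
  have : IsProbabilityMeasure (pairLaw P w₁ w₂) := Measure.isProbabilityMeasure_map (by fun_prop)
  have : IsFiniteMeasure (shift (pairLaw P w₁ w₂) (embed (S γ))) := by
    unfold shift; infer_instance
  have hint : Integrable (fun x => Real.exp (F x - 1 / 2 * ⟪γ, S γ⟫_ℝ)) (pairLaw P w₁ w₂) := by
    have hm : Measurable fun x => Real.exp (F x - 1 / 2 * ⟪γ, S γ⟫_ℝ) := by fun_prop
    rw [← hX.map_eq, integrable_map_measure hm.aestronglyMeasurable hXm.aemeasurable]
    refine ((integrable_exp_xi hw₁ hw₂ hG γ).mul_const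
      (Real.exp (-(1 / 2 * ⟪γ, S γ⟫_ℝ)))).congr ?_
    filter_upwards [hγ] with ω h
    rw [h, ← Real.exp_add, Function.comp_apply, sub_eq_add_neg]
  have := isFiniteMeasure_withDensity_ofReal hint.2
  refine ext_of_integral_exp_evalPairing fun c => ?_
  have hc := (continuous_evalPairing c).measurable
  rw [shift, integral_map (by fun_prop) (by fun_prop),
    integral_withDensity_eq_integral_toReal_smul (by fun_prop) (by simp), ← hX.map_eq,
    integral_map hXm.aemeasurable (Measurable.aestronglyMeasurable (by fun_prop)),
    integral_map hXm.aemeasurable (Measurable.aestronglyMeasurable (by fun_prop))]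
  have h1 : ∀ ω, Complex.exp (Complex.I * (evalPairing ((w₁ ω, w₂ ω) + embed (S γ)) c : ℝ))
      = Complex.exp (Complex.I * (⟪stepPair c, S γ⟫_ℝ : ℝ))
        * Complex.exp (Complex.I * (evalPairing (w₁ ω, w₂ ω) c : ℝ)) := fun ω => by
    rw [map_add, LinearMap.add_apply, evalPairing_embed, ← Complex.exp_add]
    push_cast
    ring_nf
  have h2 : ∫ ω, Complex.exp (Complex.I * (evalPairing (w₁ ω, w₂ ω) c : ℝ)) ∂P
      = Complex.exp (-(⟪stepPair c, S (stepPair c)⟫_ℝ : ℝ) / 2) := by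
    rw [hS, ← integral_exp_xi hw₁ hw₂ hG]
    refine integral_congr_ae ?_
    filter_upwards [coeFn_xi_stepPair hw₁ hw₂ c] with ω h
    rw [h]
  have h3 : ∫ ω, (ENNReal.ofReal (Real.exp (F (w₁ ω, w₂ ω) - 1 / 2 * ⟪γ, S γ⟫_ℝ))).toReal
        • Complex.exp (Complex.I * (evalPairing (w₁ ω, w₂ ω) c : ℝ)) ∂P
      = Complex.exp (-(1 / 2 * (⟪γ, S γ⟫_ℝ : ℝ)))
        * ∫ ω, Complex.exp (xi hw₁ hw₂ γ ω)
          * Complex.exp (Complex.I * xi hw₁ hw₂ (stepPair c) ω) ∂P := by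
    rw [← integral_const_mul]
    refine integral_congr_ae ?_
    filter_upwards [coeFn_xi_stepPair hw₁ hw₂ c, hγ] with ω h h'
    rw [h, h', ENNReal.toReal_ofReal (Real.exp_pos _).le, Complex.real_smul, Complex.ofReal_exp,
      ← mul_assoc]
    push_cast
    rw [sub_eq_neg_add, Complex.exp_add]
  simp_rw [h1]
  -- The normalizing factor `exp(-(γ, Sγ)/2)` cancels the tilt's total mass, leaving the phase
  -- `exp(i(φ, Sγ))` of the shift, with `φ` the step pair.
  rw [integral_const_mul, h2, h3, integral_exp_xi_mul_exp_xi hw₁ hw₂ hG, ← Complex.exp_add,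
    ← Complex.exp_add, ← hS]
  congr 1
  ring

end Density

end CorrelatedWiener

theorem lemma4p1 {Ω : Type*} [MeasurableSpace Ω] (P : Measure Ω) [IsProbabilityMeasure P]
    (w₁ w₂ : Ω → C(unitInterval, ℝ))
    (hw₁ : IsWienerProcess P w₁) (hw₂ : IsWienerProcess P w₂)
    (hG : JointlyGaussian P w₁ w₂)
    (hV : ‖crossCov hw₁ hw₂‖ < 1) :
    (covOp (crossCov hw₁ hw₂)).IsInvertible ∧
    ∀ h : L2Pair,
      IsAdmissibleShift (pairLaw P w₁ w₂)
        (embed h) ∧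
      (fun ω => (shift (pairLaw P w₁ w₂)
          (embed h)).rnDeriv (pairLaw P w₁ w₂) (w₁ ω, w₂ ω))
        =ᵐ[P] fun ω => ENNReal.ofReal (Real.exp
          (xi hw₁ hw₂
              ((covOp (crossCov hw₁ hw₂)).inverse h) ω
            - 1 / 2 * inner ℝ
              ((covOp (crossCov hw₁ hw₂)).inverse h) h)) := by
  have hS := isInvertible_covOp hV
  refine ⟨hS, fun h => ?_⟩
  -- With `h = Sγ`, the inverse disappears: `S⁻¹h = γ`.
  obtain ⟨γ, rfl⟩ := hS.surjective h
  rw [hS.inverse_apply_self]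
  obtain ⟨F, hF, hγ⟩ := exists_xi_eq_comp hw₁ hw₂ γ
  have hX := measurePreserving_pair hw₁ hw₂
  have : IsProbabilityMeasure (pairLaw P w₁ w₂) :=
    Measure.isProbabilityMeasure_map hX.measurable.aemeasurable
  rw [IsAdmissibleShift, shift_pairLaw_eq_withDensity hw₁ hw₂ hG γ hF hγ]
  refine ⟨withDensity_absolutelyContinuous _ _, ?_⟩
  -- The Radon–Nikodym derivative is known almost everywhere for the law of the pair; this is pulled
  -- back to `P` along the path map.
  have hd := hX.quasiMeasurePreserving.ae
    (Measure.rnDeriv_withDensity (pairLaw P w₁ w₂) (f := fun x => ENNReal.ofReal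
      (Real.exp (F x - 1 / 2 * ⟪γ, covOp (crossCov hw₁ hw₂) γ⟫_ℝ))) (by fun_prop))
  filter_upwards [hd, hγ] with ω h1 h2
  rw [h1, h2]
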